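/- **Setting.** Let $U\subset\mathbb{R}^d$ be a connected open set with compact complement, let $\mu_+>0$, $\mu_-\in(0,1)$, $T\ge 0$, and let $F:[0,T]\to(0,\infty)$ be Lipschitz continuous. Let $H^1_0(U)$ be the closure of $C_c^\infty(U)$ in $H^1(U)$; for a constant $c$, "$v=c$ on $\partial U$" means that $v-c\,\eta\in H^1_0(U)$ for a cutoff function $\eta\in C_c^\infty(\mathbb{R}^d)$ that equals $1$ in a neighbourhood of $\mathbb{R}^d\setminus U$. For $v\in H^1(U)$ put $\Omega(v)=\{x\in U: v(x)>0\}$ and $$\mathcal J(v)=\int_U|\nabla v|^2+\mathbf 1_{\{v>0\}}\,dx\in[0,\infty],$$ and for measurable $A,B\subset\mathbb{R}^d$ put $\operatorname{Diss}(A,B)=\mu_+|B\setminus A|+\mu_-|A\setminus B|$. The pressure of $v$ is $P(v)=\int_{\partial U}\frac{\partial v}{\partial n}\,dS$, with $n$ the outward normal of $U$, understood weakly as the common value of $\int_U\nabla v\cdot\nabla\varphi\,dx$ over all $\varphi\in H^1(U)$ with $\varphi=1$ on $\partial U$ and $\varphi=0$ a.e. in $U\setminus\Omega(v)$ (provided that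 such $\varphi$ exist and that the value does not depend on $\varphi$). A measurable map $u:[0,T]\to H^1(U)$ with $u(t)\ge0$ and $\mathcal J(u(t))<\infty$ for all $t\in[0,T]$ is an *energy solution* on $[0,T]$ driven by $F$ if 1. $u(t)=F(t)$ on $\partial U$ for all $t\in[0,T]$; 2. $\mathcal J(u(t))\le\mathcal J(v)+\operatorname{Diss}(\Omega(u(t)),\Omega(v))$ for all $t\in[0,T]$ and all $v\in u(t)+H^1_0(U)$; 3. for all $0\le t_0\le t_1\le T$, $$\mathcal J(u(t_0))-\mathcal J(u(t_1))+\int_{t_0}^{t_1}2\dot F(t)P(u(t))\,dt\ \ge\ \operatorname{Diss}(\Omega(u(t_0)),\Omega(u(t_1))).$$ For a path of sets $\Lambda(\cdot)$ let $$\overline{\operatorname{Diss}}(\Lambda(\cdot);[s,t])=\sup\Big\{\sum_{k=1}^N\operatorname{Diss}(\Lambda(t_{k-1}),\Lambda(t_k)):\ s=t_0\le t_1\le\dots\le t_N=t\Big\},$$ and call a map $f$ from $[0,T]$ to a metric space $(Y,\rho)$ of class $\mathrm{BV}([0,T];Y)$ if $\sup\sum_k \rho(f(t_k),f(t_{k-1}))<\infty$,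 the supremum being over all partitions of $[0,T]$. **Statement.** Let $u$ be an energy solution on $[0,T]$. Then (a) $t\mapsto\mathbf 1_{\Omega(u(t))}$ belongs to $\mathrm{BV}([0,T];L^1(\mathbb{R}^d))$, and $t\mapsto\mathcal J(u(t))$ and $t\mapsto P(u(t))$ belong to $\mathrm{BV}([0,T];\mathbb{R})$; here the pressure $P(u(t))$ is well defined for every $t\in[0,T]$, and $$P(u(t))=\frac1{F(t)}\int_U|\nabla u(t)|^2\,dx .$$ (b) The function $\dot F\,P(u(\cdot))$ is integrable on $[0,T]$, and for all $s\le t$ in $[0,T]$ the total dissipation $\overline{\operatorname{Diss}}(\Omega(u(\cdot));[s,t])$ is finite and $$\mathcal J(u(s))-\mathcal J(u(t))+\int_s^t2\dot F(\tau)P(u(\tau))\,d\tau=\overline{\operatorname{Diss}}(\Omega(u(\cdot));[s,t]).$$ -/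

import Mathlib

open MeasureTheory Set Filter Topology
open scoped ENNReal ContDiff

noncomputable section

namespace Droplet

/-- Euclidean space of dimension `d`. -/
abbrev Euc (d : ℕ) : Type := EuclideanSpace ℝ (Fin d)

/-- Smooth functions on the whole space with compact support contained in `U`. -/
def IsTest {d : ℕ} (U : Set (Euc d)) (φ : Euc d → ℝ) : Prop :=
  ContDiff ℝ ∞ φ ∧ HasCompactSupport φ ∧ tsupport φ ⊆ U

/-- `g` is the weak (distributional) gradient of `u` in `U`. -/
def IsWeakGradient {d : ℕ} (U : Set (Euc d)) (u : Euc d → ℝ) (g : Euc d → Euc d) : Prop :=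
  ∀ φ : Euc d → ℝ, IsTest U φ → ∀ v : Euc d,
    ∫ x in U, u x * fderiv ℝ φ x v = - ∫ x in U, φ x * inner ℝ (g x) v

/-- The ambient space of pairs (function, vector field), square integrable on `U`. -/
abbrev L2Pair {d : ℕ} (U : Set (Euc d)) : Type :=
  Lp ℝ 2 (volume.restrict U) × Lp (Euc d) 2 (volume.restrict U)

theorem IsTest.memLp {d : ℕ} {U : Set (Euc d)} {φ : Euc d → ℝ} (h : IsTest U φ) :
    MemLp φ 2 (volume.restrict U) :=
  (h.1.continuous.memLp_of_hasCompactSupport h.2.1).restrict U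

theorem IsTest.memLp_fderiv {d : ℕ} {U : Set (Euc d)} {φ : Euc d → ℝ} (h : IsTest U φ)
    (v : Euc d) : MemLp (fun x => fderiv ℝ φ x v) 2 (volume.restrict U) := by
  have hc : Continuous (fun x => fderiv ℝ φ x v) :=
    (h.1.continuous_fderiv (by simp)).clm_apply continuous_const
  exact (hc.memLp_of_hasCompactSupport (h.2.1.fderiv_apply ℝ v)).restrict U

theorem IsTest.integrable_left {d : ℕ} {U : Set (Euc d)} {φ : Euc d → ℝ} (h : IsTest U φ)
    (u : Lp ℝ 2 (volume.restrict U)) (v : Euc d) :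
    Integrable (fun x => u x * fderiv ℝ φ x v) (volume.restrict U) :=
  (Lp.memLp u).integrable_mul (h.memLp_fderiv v)

theorem IsTest.integrable_right {d : ℕ} {U : Set (Euc d)} {φ : Euc d → ℝ} (h : IsTest U φ)
    (g : Lp (Euc d) 2 (volume.restrict U)) (v : Euc d) :
    Integrable (fun x => φ x * inner ℝ (g x) v) (volume.restrict U) :=
  h.memLp.integrable_mul ((Lp.memLp g).inner_const v)

/-- The Sobolev space `H¹(U)`: square integrable functions with square integrable weak gradient,
each stored together with its gradient.  The topology is the one induced by the product of the two
`L²` spaces, that is, the usual topology of `H¹(U)`. -/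
def H1 {d : ℕ} (U : Set (Euc d)) : Submodule ℝ (L2Pair U) where
  carrier := {p | IsWeakGradient U p.1 p.2}
  zero_mem' := by
    intro φ hφ v
    have h1 : (fun x => (0 : Lp ℝ 2 (volume.restrict U)) x * fderiv ℝ φ x v)
        =ᵐ[volume.restrict U] fun _ => 0 := by
      filter_upwards [Lp.coeFn_zero ℝ 2 (volume.restrict U)] with x hx
      rw [hx, Pi.zero_apply, zero_mul]
    have h2 : (fun x => φ x * inner ℝ ((0 : Lp (Euc d) 2 (volume.restrict U)) x) v)
        =ᵐ[volume.restrict U] fun _ => 0 := by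
      filter_upwards [Lp.coeFn_zero (Euc d) 2 (volume.restrict U)] with x hx
      rw [hx, Pi.zero_apply, inner_zero_left, mul_zero]
    simp only [Prod.fst_zero, Prod.snd_zero]
    rw [integral_congr_ae h1, integral_congr_ae h2]
    simp
  add_mem' := by
    rintro ⟨a, g⟩ ⟨b, k⟩ ha hb φ hφ v
    have h1 : (fun x => (a + b) x * fderiv ℝ φ x v)
        =ᵐ[volume.restrict U] fun x => a x * fderiv ℝ φ x v + b x * fderiv ℝ φ x v := by
      filter_upwards [Lp.coeFn_add a b] with x hx
      rw [hx, Pi.add_apply, add_mul]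
    have h2 : (fun x => φ x * inner ℝ ((g + k) x) v)
        =ᵐ[volume.restrict U] fun x => φ x * inner ℝ (g x) v + φ x * inner ℝ (k x) v := by
      filter_upwards [Lp.coeFn_add g k] with x hx
      rw [hx, Pi.add_apply, inner_add_left, mul_add]
    have ha' := ha φ hφ v
    have hb' := hb φ hφ v
    simp only [Prod.mk_add_mk] at ha' hb' ⊢
    rw [integral_congr_ae h1, integral_congr_ae h2,
      integral_add (hφ.integrable_left a v) (hφ.integrable_left b v),
      integral_add (hφ.integrable_right g v) (hφ.integrable_right k v), ha', hb']
    ring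
  smul_mem' := by
    rintro c ⟨a, g⟩ ha φ hφ v
    have h1 : (fun x => (c • a) x * fderiv ℝ φ x v)
        =ᵐ[volume.restrict U] fun x => c * (a x * fderiv ℝ φ x v) := by
      filter_upwards [Lp.coeFn_smul c a] with x hx
      rw [hx, Pi.smul_apply, smul_eq_mul, mul_assoc]
    have h2 : (fun x => φ x * inner ℝ ((c • g) x) v)
        =ᵐ[volume.restrict U] fun x => c * (φ x * inner ℝ (g x) v) := by
      filter_upwards [Lp.coeFn_smul c g] with x hx
      rw [hx, Pi.smul_apply, real_inner_smul_left]
      ring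
    have ha' := ha φ hφ v
    simp only [Prod.smul_mk] at ha' ⊢
    rw [integral_congr_ae h1, integral_congr_ae h2, integral_const_mul, integral_const_mul, ha']
    ring

/-- The function underlying an element of `H¹(U)` (only its values a.e. in `U` matter). -/
def fn {d : ℕ} {U : Set (Euc d)} (u : H1 U) : Euc d → ℝ := u.1.1

/-- The weak gradient of an element of `H¹(U)`. -/
def grad {d : ℕ} {U : Set (Euc d)} (u : H1 U) : Euc d → Euc d := u.1.2

/-- `H¹₀(U)`: the closure in `H¹(U)` of the smooth functions with compact support in `U`. -/
def H10 {d : ℕ} (U : Set (Euc d)) : Submodule ℝ (H1 U) :=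
  (Submodule.span ℝ {p : L2Pair U | ∃ φ : Euc d → ℝ, IsTest U φ ∧
    p.1 =ᵐ[volume.restrict U] φ ∧ p.2 =ᵐ[volume.restrict U] gradient φ}).topologicalClosure.comap
    (H1 U).subtype

/-- `e ∈ H¹(U)` is the restriction to `U` of a smooth compactly supported function that is equal
to one in a neighbourhood of the complement of `U`. -/
def IsCutoff {d : ℕ} {U : Set (Euc d)} (e : H1 U) : Prop :=
  ∃ η : Euc d → ℝ, ContDiff ℝ ∞ η ∧ HasCompactSupport η ∧ (∀ᶠ x in 𝓝ˢ Uᶜ, η x = 1) ∧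
    fn e =ᵐ[volume.restrict U] η ∧ grad e =ᵐ[volume.restrict U] gradient η

/-- `u = c` on `∂U` in the sense of traces, that is `u ∈ c + H¹₀(U)`, for a domain `U` with compact
complement and a constant `c`.  The constant is cut off away from `∂U` to make it an element of
`H¹(U)`; the choice of the cutoff is immaterial. -/
def HasTrace {d : ℕ} {U : Set (Euc d)} (u : H1 U) (c : ℝ) : Prop :=
  ∃ e : H1 U, IsCutoff e ∧ u - c • e ∈ H10 U

/-- The positivity set `Ω(u) = {u > 0}`. -/
def posSet {d : ℕ} {U : Set (Euc d)} (u : H1 U) : Set (Euc d) := {x ∈ U | 0 < fn u x}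

/-- The one-phase energy `𝓙(u) = ∫_U |∇u|² + 1_{u > 0} dx`, with values in `[0, ∞]`. -/
def energy {d : ℕ} {U : Set (Euc d)} (u : H1 U) : ℝ≥0∞ :=
  ∫⁻ x in U, (‖grad u x‖ₑ ^ 2 + (posSet u).indicator 1 x)

/-- The dissipation distance `Diss(A, B) = μ₊ |B \ A| + μ₋ |A \ B|`, with values in `[0, ∞]`. -/
def diss {d : ℕ} (μp μm : ℝ) (A B : Set (Euc d)) : ℝ≥0∞ :=
  ENNReal.ofReal μp * volume (B \ A) + ENNReal.ofReal μm * volume (A \ B)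

/-- The total variation of the dissipation distance along a path of sets: the supremum of
`∑ Diss(Λ(t_{k-1}), Λ(t_k))` over the partitions `s = t_0 ≤ ⋯ ≤ t_N = t`. -/
def dissBar {d : ℕ} (μp μm : ℝ) (Λ : ℝ → Set (Euc d)) (s t : ℝ) : ℝ≥0∞ :=
  ⨆ (N : ℕ) (τ : ℕ → ℝ) (_ : Monotone τ ∧ τ 0 = s ∧ τ N = t),
    ∑ k ∈ Finset.range N, diss μp μm (Λ (τ k)) (Λ (τ (k + 1)))

/-- `p` is the value of the flux `∫_{∂U} ∂u/∂n dS`, with `n` the normal pointing out of `U`, in the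
weak sense, through Green's formula `∫_{∂U} φ ∂u/∂n dS = ∫_U ∇u · ∇φ + φ Δu dx` for functions `φ`
that are equal to one on `∂U` and vanish off `{u > 0}` (in which `u` is to be harmonic). -/
def IsFlux {d : ℕ} {U : Set (Euc d)} (u : H1 U) (p : ℝ) : Prop :=
  (∃ φ : H1 U, HasTrace φ 1 ∧ ∀ᵐ x ∂(volume.restrict U), x ∉ posSet u → fn φ x = 0) ∧
  ∀ φ : H1 U, HasTrace φ 1 → (∀ᵐ x ∂(volume.restrict U), x ∉ posSet u → fn φ x = 0) →
    ∫ x in U, inner ℝ (grad u x) (grad φ x) = p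

/-- The pressure `P(u) = ∫_{∂U} ∂u/∂n dS` (an arbitrary number if there is no weak flux). -/
def pressure {d : ℕ} {U : Set (Euc d)} (u : H1 U) : ℝ := Classical.epsilon (IsFlux u)

/-- Energy solutions on `[0, T]` of the quasi-static evolution driven by the Dirichlet forcing `F`.
Only the values of `u` and `F` on `[0, T]` are relevant. -/
structure IsEnergySolution {d : ℕ} (U : Set (Euc d)) (μp μm T : ℝ) (F : ℝ → ℝ)
    (u : ℝ → H1 U) : Prop where
  measurable : AEStronglyMeasurable u (volume.restrict (Icc 0 T))
  nonneg : ∀ t ∈ Icc 0 T, ∀ᵐ x ∂(volume.restrict U), 0 ≤ fn (u t) x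
  finite_energy : ∀ t ∈ Icc 0 T, energy (u t) ≠ ⊤
  forcing : ∀ t ∈ Icc 0 T, HasTrace (u t) (F t)
  stability : ∀ t ∈ Icc 0 T, ∀ v : H1 U, v - u t ∈ H10 U →
    energy (u t) ≤ energy v + diss μp μm (posSet (u t)) (posSet v)
  dissipation : ∀ t₀ t₁ : ℝ, 0 ≤ t₀ → t₀ ≤ t₁ → t₁ ≤ T →
    (diss μp μm (posSet (u t₀)) (posSet (u t₁))).toReal ≤
      (energy (u t₀)).toReal - (energy (u t₁)).toReal
        + ∫ t in t₀..t₁, 2 * deriv F t * pressure (u t)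

end Droplet

end

namespace Droplet

/-! Write `J = G + V`, with `G` the Dirichlet energy and `V` the measure of the positivity set.
Perturbing `u` inside its positivity set costs no dissipation beyond the measure released, because
`μm ≤ 1`. Hence stability makes the first variation of `G` vanish (`IsStable.inner_eq_zero`), and
testing with `φ - u / F` gives `P = G / F`. Comparison with multiples of a fixed cutoff bounds `G`
uniformly in time.

What remains is one-dimensional (`exists_antitoneOn_dominating`). The dissipation inequality says
that `D(t) = J(t) - ∫₀ᵗ 2 F' P` decreases by at least the dissipation. Since dissipation controls
changes of `V`, a combination `H = α D - β t` dominates the increments of the sets, of `J` and of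
`P`, which gives bounded variation.

Telescoping `D` along partitions bounds the total dissipation from above. Conversely, stability of
`u(a)` against `(F a / F b) u(b)` gives `D(a) - D(b) ≤ Diss + C (b - a) (H a - H b)`; the
first-order terms cancel because `P = G / F`. Summed over a uniform partition, the errors are at
most mesh times the total decrease of `H`, so they vanish in the limit (`sub_le_of_increment_le`).
-/

variable {d : ℕ} {U : Set (Euc d)}

/-! ### Representatives, energy and positivity sets in `H¹` -/

theorem fn_sub (u v : H1 U) : fn (u - v) =ᵐ[volume.restrict U] fun x => fn u x - fn v x :=
  Lp.coeFn_sub u.1.1 v.1.1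

theorem fn_add (u v : H1 U) : fn (u + v) =ᵐ[volume.restrict U] fun x => fn u x + fn v x :=
  Lp.coeFn_add u.1.1 v.1.1

theorem fn_smul (c : ℝ) (u : H1 U) : fn (c • u) =ᵐ[volume.restrict U] fun x => c * fn u x :=
  Lp.coeFn_smul c u.1.1

theorem grad_sub (u v : H1 U) :
    grad (u - v) =ᵐ[volume.restrict U] fun x => grad u x - grad v x :=
  Lp.coeFn_sub u.1.2 v.1.2

theorem measurableSet_posSet (hU : IsOpen U) (u : H1 U) : MeasurableSet (posSet u) :=
  hU.measurableSet.inter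
    (measurableSet_lt measurable_const (Lp.stronglyMeasurable u.1.1).measurable)

theorem posSet_subset (u : H1 U) : posSet u ⊆ U := fun _ hx => hx.1

/-- The Dirichlet energy, as the squared norm of the gradient in `L²`. -/
theorem lintegral_grad_sq (u : H1 U) :
    ∫⁻ x in U, ‖grad u x‖ₑ ^ 2 = ENNReal.ofReal (‖u.1.2‖ ^ 2) := by
  have h := eLpNorm_nnreal_pow_eq_lintegral (p := 2) (μ := volume.restrict U) (f := grad u)
    (by norm_num)
  have h' : eLpNorm (grad u) 2 (volume.restrict U) = ENNReal.ofReal ‖u.1.2‖ := by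
    rw [ofReal_norm, Lp.enorm_def]
    rfl
  rw [ENNReal.ofReal_pow (norm_nonneg _), ← h']
  simpa using h.symm

theorem integral_inner_grad (u v : H1 U) :
    ∫ x in U, inner ℝ (grad u x) (grad v x) = inner ℝ u.1.2 v.1.2 :=
  (L2.inner_def u.1.2 v.1.2).symm

theorem integral_grad_sq (u : H1 U) : ∫ x in U, ‖grad u x‖ ^ 2 = ‖u.1.2‖ ^ 2 := by
  rw [← real_inner_self_eq_norm_sq, ← integral_inner_grad]
  simp only [real_inner_self_eq_norm_sq]

theorem energy_eq (hU : IsOpen U) (u : H1 U) :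
    energy u = ENNReal.ofReal (‖u.1.2‖ ^ 2) + volume (posSet u) := by
  have hm := measurableSet_posSet hU u
  rw [energy, lintegral_add_right _ (measurable_one.indicator hm), lintegral_grad_sq,
    lintegral_indicator_one hm, Measure.restrict_apply hm,
    inter_eq_self_of_subset_left (posSet_subset u)]

theorem volume_posSet_ne_top (hU : IsOpen U) {u : H1 U} (h : energy u ≠ ⊤) :
    volume (posSet u) ≠ ⊤ := by
  rw [energy_eq hU] at h
  exact (ENNReal.add_ne_top.1 h).2

theorem energy_toReal (hU : IsOpen U) {u : H1 U} (h : energy u ≠ ⊤) :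
    (energy u).toReal = ‖u.1.2‖ ^ 2 + volume.real (posSet u) := by
  rw [energy_eq hU, ENNReal.toReal_add ENNReal.ofReal_ne_top (volume_posSet_ne_top hU h),
    ENNReal.toReal_ofReal (by positivity), measureReal_def]

theorem posSet_ae_subset (hU : IsOpen U) {u v : H1 U}
    (h : ∀ᵐ x ∂(volume.restrict U), 0 < fn v x → 0 < fn u x) :
    posSet v ≤ᵐ[volume] posSet u := by
  filter_upwards [(ae_restrict_iff' hU.measurableSet).1 h] with x hx hv
  exact ⟨hv.1, hx hv.1 hv.2⟩

/-- Representatives of `c • u` and `u` are proportional only a.e., so equality of sets is a.e. too;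
volumes and dissipation do not see the difference. -/
theorem posSet_smul_ae (hU : IsOpen U) {c : ℝ} (hc : 0 < c) (u : H1 U) :
    posSet (c • u) =ᵐ[volume] posSet u := by
  refine (posSet_ae_subset hU ?_).antisymm (posSet_ae_subset hU ?_) <;>
    filter_upwards [fn_smul c u] with x hx h
  · rw [hx] at h
    exact pos_of_mul_pos_right h hc.le
  · rw [hx]
    positivity

/-! ### Traces and cutoffs -/

/-- Two cutoffs agree near the complement of `U`, so their difference is a test function. This makes
traces independent of the cutoff. -/
theorem IsCutoff.sub_mem_H10 {e e' : H1 U} (h : IsCutoff e) (h' : IsCutoff e') :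
    e - e' ∈ H10 U := by
  obtain ⟨η, hs, hc, h1, hf, hg⟩ := h
  obtain ⟨η', hs', hc', h1', hf', hg'⟩ := h'
  refine Submodule.le_topologicalClosure _ (Submodule.subset_span
    ⟨fun x => η x - η' x, ⟨hs.sub hs', hc.sub hc', ?_⟩, ?_, ?_⟩)
  · intro x hx
    by_contra hxU
    have h0 : (fun x => η x - η' x) =ᶠ[𝓝 x] 0 := by
      filter_upwards [nhds_le_nhdsSet (show x ∈ Uᶜ from hxU) h1,
        nhds_le_nhdsSet (show x ∈ Uᶜ from hxU) h1'] with y hy hy'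
      simp [hy, hy']
    exact (notMem_tsupport_iff_eventuallyEq.2 h0) hx
  · filter_upwards [fn_sub e e', hf, hf'] with x hx hy hz
    rw [← hy, ← hz]
    exact hx
  · filter_upwards [grad_sub e e', hg, hg'] with x hx hy hz
    refine hx.trans ?_
    have hd : DifferentiableAt ℝ η x := (hs.differentiable (by simp)).differentiableAt
    have hd' : DifferentiableAt ℝ η' x := (hs'.differentiable (by simp)).differentiableAt
    rw [hy, hz, gradient, gradient, gradient, ← map_sub]
    congr 1
    exact (fderiv_fun_sub hd hd').symm

theorem HasTrace.sub_mem_H10 {u v : H1 U} {c : ℝ} (hu : HasTrace u c) (hv : HasTrace v c) :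
    u - v ∈ H10 U := by
  obtain ⟨e, he, hu⟩ := hu
  obtain ⟨e', he', hv⟩ := hv
  have h := (H10 U).add_mem ((H10 U).sub_mem hu hv) ((H10 U).smul_mem c (he.sub_mem_H10 he'))
  convert h using 1
  module

theorem HasTrace.smul {u : H1 U} {c : ℝ} (hu : HasTrace u c) (a : ℝ) :
    HasTrace (a • u) (a * c) := by
  obtain ⟨e, he, hu⟩ := hu
  refine ⟨e, he, ?_⟩
  convert (H10 U).smul_mem a hu using 1
  module

theorem IsCutoff.hasTrace {e : H1 U} (h : IsCutoff e) (c : ℝ) : HasTrace (c • e) c :=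
  ⟨e, h, by simp⟩

theorem IsCutoff.volume_posSet_ne_top (hU : IsOpen U) {e : H1 U} (h : IsCutoff e) :
    volume (posSet e) ≠ ⊤ := by
  obtain ⟨η, hs, hc, -, hf, -⟩ := h
  have h1 : posSet e ≤ᵐ[volume] tsupport η := by
    filter_upwards [(ae_restrict_iff' hU.measurableSet).1 hf] with x hx hv
    refine subset_tsupport η ?_
    rw [Function.mem_support, ← hx hv.1]
    exact hv.2.ne'
  exact ((measure_mono_ae h1).trans_lt hc.measure_lt_top).ne

/-! ### The dissipation distance -/

theorem diss_ne_top {μp μm : ℝ} {A B : Set (Euc d)} (hA : volume A ≠ ⊤) (hB : volume B ≠ ⊤) :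
    diss μp μm A B ≠ ⊤ :=
  ENNReal.add_ne_top.2
    ⟨ENNReal.mul_ne_top ENNReal.ofReal_ne_top (measure_ne_top_of_subset sdiff_subset hB),
      ENNReal.mul_ne_top ENNReal.ofReal_ne_top (measure_ne_top_of_subset sdiff_subset hA)⟩

theorem diss_congr_right {μp μm : ℝ} {A B B' : Set (Euc d)} (h : B =ᵐ[volume] B') :
    diss μp μm A B = diss μp μm A B' := by
  rw [diss, diss, measure_congr (h.diff (ae_eq_refl A)), measure_congr ((ae_eq_refl A).diff h)]

theorem diss_toReal {μp μm : ℝ} (hp : 0 ≤ μp) (hm : 0 ≤ μm) {A B : Set (Euc d)}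
    (hA : volume A ≠ ⊤) (hB : volume B ≠ ⊤) :
    (diss μp μm A B).toReal = μp * volume.real (B \ A) + μm * volume.real (A \ B) := by
  rw [diss, ENNReal.toReal_add, ENNReal.toReal_mul, ENNReal.toReal_mul, ENNReal.toReal_ofReal hp,
    ENNReal.toReal_ofReal hm, measureReal_def, measureReal_def]
  · exact ENNReal.mul_ne_top ENNReal.ofReal_ne_top (measure_ne_top_of_subset sdiff_subset hB)
  · exact ENNReal.mul_ne_top ENNReal.ofReal_ne_top (measure_ne_top_of_subset sdiff_subset hA)

/-! ### Stability, first variation and flux -/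

/-- Stability of `u`, as required of an energy solution at each time. -/
def IsStable (μp μm : ℝ) (u : H1 U) : Prop :=
  ∀ v : H1 U, v - u ∈ H10 U → energy u ≤ energy v + diss μp μm (posSet u) (posSet v)

theorem IsStable.toReal_le (hU : IsOpen U) {μp μm : ℝ} {u v : H1 U}
    (h : IsStable μp μm u) (hu : energy u ≠ ⊤) (hv : volume (posSet v) ≠ ⊤)
    (huv : v - u ∈ H10 U) :
    ‖u.1.2‖ ^ 2 + volume.real (posSet u) ≤ ‖v.1.2‖ ^ 2 + volume.real (posSet v) +
      (diss μp μm (posSet u) (posSet v)).toReal := by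
  have hev : energy v ≠ ⊤ := by
    rw [energy_eq hU]
    exact ENNReal.add_ne_top.2 ⟨ENNReal.ofReal_ne_top, hv⟩
  have hd := diss_ne_top (μp := μp) (μm := μm) (volume_posSet_ne_top hU hu) hv
  rw [← energy_toReal hU hu, ← energy_toReal hU hev, ← ENNReal.toReal_add hev hd]
  exact ENNReal.toReal_mono (ENNReal.add_ne_top.2 ⟨hev, hd⟩) (h v huv)

/-- A stable function minimizes the Dirichlet energy among functions that vanish off its positivity
set. -/
theorem IsStable.inner_eq_zero (hU : IsOpen U) {μp μm : ℝ} (hp : 0 ≤ μp) (hm : 0 ≤ μm)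
    (hm1 : μm ≤ 1) {u ψ : H1 U} (h : IsStable μp μm u) (hu : energy u ≠ ⊤)
    (hψ : ψ ∈ H10 U) (h0 : ∀ᵐ x ∂(volume.restrict U), x ∉ posSet u → fn ψ x = 0)
    (hn : ∀ᵐ x ∂(volume.restrict U), 0 ≤ fn u x) :
    inner ℝ u.1.2 ψ.1.2 = 0 := by
  have hA := volume_posSet_ne_top hU hu
  have key : ∀ ε : ℝ, ‖u.1.2‖ ^ 2 ≤ ‖u.1.2 + ε • ψ.1.2‖ ^ 2 := by
    intro ε
    set v : H1 U := u + ε • ψ with hv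
    have hsub : posSet v ≤ᵐ[volume] posSet u := by
      refine posSet_ae_subset hU ?_
      filter_upwards [h0, fn_add u (ε • ψ), fn_smul ε ψ, ae_restrict_mem hU.measurableSet, hn]
        with x h0 h1 h2 hxU hn hpos
      by_contra hneg
      have h3 := h0 fun hx => hneg hx.2
      rw [hv, h1, h2, h3] at hpos
      exact hneg (by simpa using hpos)
    have hB : volume (posSet v) ≠ ⊤ := ((measure_mono_ae hsub).trans_lt hA.lt_top).ne
    have hBA : volume.real (posSet v \ posSet u) = 0 := by
      rw [measureReal_def, ae_le_set.1 hsub, ENNReal.toReal_zero]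
    have hAB : volume.real (posSet u \ posSet v) =
        volume.real (posSet u) - volume.real (posSet v) := by
      have e1 := measureReal_inter_add_sdiff (μ := volume) (s := posSet u)
        (measurableSet_posSet hU v) hA
      have e2 := measureReal_inter_add_sdiff (μ := volume) (s := posSet v)
        (measurableSet_posSet hU u) hB
      rw [inter_comm] at e2
      linarith
    have := h.toReal_le hU hu hB (by simpa [hv] using (H10 U).smul_mem ε hψ)
    rw [diss_toReal hp hm hA hB, hBA] at this
    have hnn : 0 ≤ volume.real (posSet u \ posSet v) := measureReal_nonneg
    have hG : ‖v.1.2‖ ^ 2 = ‖u.1.2 + ε • ψ.1.2‖ ^ 2 := rfl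
    -- Losing the set `A \ B` lowers the measure term by its volume and costs only `μm ≤ 1` times
    -- that volume.
    nlinarith
  set b : ℝ := inner ℝ u.1.2 ψ.1.2 with hb
  set q : ℝ := ‖ψ.1.2‖ ^ 2 with hq
  have hq0 : 0 ≤ q := by positivity
  have hexp : ∀ ε : ℝ, 0 ≤ 2 * ε * b + ε ^ 2 * q := by
    intro ε
    have := key ε
    rw [norm_add_sq_real, norm_smul, mul_pow, Real.norm_eq_abs, sq_abs, real_inner_smul_right]
      at this
    linarith
  -- The minimizer would be `-b / q`; the `+ 1` covers `q = 0`.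
  have h1 := hexp (-b / (q + 1))
  have h2 : 2 * (-b / (q + 1)) * b + (-b / (q + 1)) ^ 2 * q = -(b ^ 2 * (q + 2) / (q + 1) ^ 2) := by
    field_simp
    ring
  rw [h2] at h1
  by_contra hb0
  have : 0 < b ^ 2 * (q + 2) / (q + 1) ^ 2 := by positivity
  linarith

/-- The existence clause of `IsFlux` supplies a test function that pins the value down, so
`pressure` is determined as soon as a flux exists. -/
theorem IsFlux.unique {u : H1 U} {p q : ℝ} (hp : IsFlux u p) (hq : IsFlux u q) : p = q := by
  obtain ⟨⟨φ, h1, h2⟩, h⟩ := hp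
  rw [← h φ h1 h2, ← hq.2 φ h1 h2]

/-- The pressure of a stable function exists, and is given by the Dirichlet energy. -/
theorem IsStable.isFlux (hU : IsOpen U) {μp μm : ℝ} (hp : 0 ≤ μp) (hm : 0 ≤ μm)
    (hm1 : μm ≤ 1) {u : H1 U} {c : ℝ} (h : IsStable μp μm u) (hu : energy u ≠ ⊤)
    (hn : ∀ᵐ x ∂(volume.restrict U), 0 ≤ fn u x) (hc : 0 < c) (ht : HasTrace u c) :
    IsFlux u (c⁻¹ * ‖u.1.2‖ ^ 2) := by
  have ht1 : HasTrace (c⁻¹ • u) 1 := by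
    have := ht.smul c⁻¹
    rwa [inv_mul_cancel₀ hc.ne'] at this
  have hv : ∀ᵐ x ∂(volume.restrict U), x ∉ posSet u → fn (c⁻¹ • u) x = 0 := by
    filter_upwards [hn, fn_smul c⁻¹ u, ae_restrict_mem hU.measurableSet] with x hx h1 hxU hnp
    have : fn u x = 0 := le_antisymm (not_lt.1 fun hlt => hnp ⟨hxU, hlt⟩) hx
    rw [h1, this, mul_zero]
  refine ⟨⟨c⁻¹ • u, ht1, hv⟩, fun φ hφ hφ0 => ?_⟩
  -- Both `φ` and `u / c` have trace one and vanish off the positivity set, so their difference is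
  -- an admissible variation.
  have h0 : inner ℝ u.1.2 (φ - c⁻¹ • u).1.2 = 0 := by
    refine h.inner_eq_zero hU hp hm hm1 hu (hφ.sub_mem_H10 ht1) ?_ hn
    filter_upwards [hφ0, hv, fn_sub φ (c⁻¹ • u)] with x h1 h2 h3 hx
    rw [h3, h1 hx, h2 hx, sub_zero]
  have h1 : (φ - c⁻¹ • u).1.2 = φ.1.2 - c⁻¹ • u.1.2 := rfl
  rw [h1, inner_sub_right, real_inner_smul_right, real_inner_self_eq_norm_sq, sub_eq_zero] at h0
  rw [integral_inner_grad, h0]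

theorem IsFlux.pressure_eq {u : H1 U} {p : ℝ} (h : IsFlux u p) : pressure u = p :=
  IsFlux.unique (Classical.epsilon_spec (p := IsFlux u) ⟨p, h⟩) h


/-! ### Variation and telescoping on an interval -/

/-- A cost that is dominated by the decrease of an antitone function has bounded total variation. -/
theorem sum_cost_le_of_antitoneOn {c : ℝ → ℝ → ℝ≥0∞} {H : ℝ → ℝ} {S : Set ℝ}
    (hH : AntitoneOn H S)
    (h : ∀ a ∈ S, ∀ b ∈ S, a ≤ b → c a b ≤ ENNReal.ofReal (H a - H b)) {τ : ℕ → ℝ}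
    (hτ : Monotone τ) {N : ℕ} (hS : ∀ k ≤ N, τ k ∈ S) :
    ∑ k ∈ Finset.range N, c (τ k) (τ (k + 1)) ≤ ENNReal.ofReal (H (τ 0) - H (τ N)) := by
  have hs : ∀ k ∈ Finset.range N, τ k ∈ S ∧ τ (k + 1) ∈ S := fun k hk =>
    ⟨hS k (Finset.mem_range.1 hk).le, hS (k + 1) (Finset.mem_range.1 hk)⟩
  refine (Finset.sum_le_sum fun k hk =>
    h _ (hs k hk).1 _ (hs k hk).2 (hτ k.le_succ)).trans_eq ?_
  rw [← ENNReal.ofReal_sum_of_nonneg fun k hk =>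
    sub_nonneg.2 (hH (hs k hk).1 (hs k hk).2 (hτ k.le_succ)), Finset.sum_range_sub']

theorem boundedVariationOn_of_edist_le {E : Type*} [PseudoEMetricSpace E] {f : ℝ → E} {H : ℝ → ℝ}
    {T : ℝ} (hH : AntitoneOn H (Icc 0 T))
    (h : ∀ a ∈ Icc 0 T, ∀ b ∈ Icc 0 T, a ≤ b → edist (f a) (f b) ≤ ENNReal.ofReal (H a - H b)) :
    BoundedVariationOn f (Icc 0 T) := by
  refine ne_top_of_le_ne_top (ENNReal.ofReal_ne_top (r := H 0 - H T)) (iSup_le ?_)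
  rintro ⟨N, τ, hτ, hmem⟩
  simp only [edist_comm (f (τ (_ + 1)))]
  refine (sum_cost_le_of_antitoneOn hH h hτ fun k _ => hmem k).trans (ENNReal.ofReal_le_ofReal ?_)
  have hT : (0 : ℝ) ≤ T := (hmem 0).1.trans (hmem 0).2
  exact sub_le_sub (hH (left_mem_Icc.2 hT) (hmem 0) (hmem 0).1)
    (hH (hmem N) (right_mem_Icc.2 hT) (hmem N).2)

/-- If the decrease of `E` on short intervals is bounded by a cost `δ` up to an error that is of
higher order, then its total decrease is bounded by the total variation of the cost. -/
theorem sub_le_of_increment_le {E H : ℝ → ℝ} {δ : ℝ → ℝ → ℝ} {C B s t : ℝ} (hst : s ≤ t)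
    (h : ∀ a ∈ Icc s t, ∀ b ∈ Icc s t, a ≤ b →
      E a - E b ≤ δ a b + C * (b - a) * (H a - H b))
    (hB : ∀ (N : ℕ) (τ : ℕ → ℝ), Monotone τ → τ 0 = s → τ N = t →
      ∑ k ∈ Finset.range N, δ (τ k) (τ (k + 1)) ≤ B) :
    E s - E t ≤ B := by
  have key : ∀ N : ℕ, E s - E t ≤ B + C * (t - s) * (H s - H t) * (1 / ((N : ℝ) + 1)) := by
    intro n
    -- Uniform partition into `n + 1` pieces, so that the mesh `r` never divides by zero.
    set N : ℕ := n + 1 with hN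
    have hN0 : (0 : ℝ) < (n : ℝ) + 1 := by positivity
    set r : ℝ := (t - s) / ((n : ℝ) + 1) with hr
    have hr0 : 0 ≤ r := div_nonneg (sub_nonneg.2 hst) hN0.le
    set τ : ℕ → ℝ := fun k => s + k * r with hτ
    have hmono : Monotone τ := fun i j hij => by
      have : (i : ℝ) ≤ j := by exact_mod_cast hij
      simp only [hτ]
      gcongr
    have h0 : τ 0 = s := by simp [hτ]
    have hNt : τ N = t := by
      simp only [hτ, hr, hN, Nat.cast_add, Nat.cast_one]
      field_simp
      ring
    have hmem : ∀ k ≤ N, τ k ∈ Icc s t := fun k hk =>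
      ⟨h0 ▸ hmono k.zero_le, hNt ▸ hmono hk⟩
    calc E s - E t = ∑ k ∈ Finset.range N, (E (τ k) - E (τ (k + 1))) := by
          rw [Finset.sum_range_sub', h0, hNt]
      _ ≤ ∑ k ∈ Finset.range N,
            (δ (τ k) (τ (k + 1)) + C * r * (H (τ k) - H (τ (k + 1)))) := by
          refine Finset.sum_le_sum fun k hk => ?_
          have hk' := Finset.mem_range.1 hk
          have := h _ (hmem k hk'.le) _ (hmem (k + 1) hk') (hmono k.le_succ)
          have hstep : τ (k + 1) - τ k = r := by
            simp only [hτ, Nat.cast_add, Nat.cast_one]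
            ring
          rwa [hstep] at this
      _ = ∑ k ∈ Finset.range N, δ (τ k) (τ (k + 1)) + C * r * (H s - H t) := by
          rw [Finset.sum_add_distrib, ← Finset.mul_sum, Finset.sum_range_sub', h0, hNt]
      _ ≤ B + C * r * (H s - H t) := by
          gcongr
          exact hB N τ hmono h0 hNt
      _ = _ := by
          rw [hr]
          ring
  have hlim : Tendsto (fun N : ℕ => B + C * (t - s) * (H s - H t) * (1 / ((N : ℝ) + 1))) atTop
      (𝓝 (B + C * (t - s) * (H s - H t) * 0)) :=
    (tendsto_one_div_add_atTop_nhds_zero_nat.const_mul _).const_add _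
  simpa using ge_of_tendsto' hlim key

/-- Strict inequalities are needed: at the endpoints `deriv F` depends on values of `F` outside `[0,
T]`. -/
theorem norm_deriv_le_of_lipschitzOn_Icc {F : ℝ → ℝ} {K : NNReal} {T τ : ℝ}
    (hF : LipschitzOnWith K F (Icc 0 T)) (h0 : 0 < τ) (hT : τ < T) : |deriv F τ| ≤ K :=
  norm_deriv_le_of_lipschitzOn (Icc_mem_nhds h0 hT) hF

/-- A bound in the interior of an interval controls the integral over it. -/
theorem abs_integral_le_of_interior {f : ℝ → ℝ} {C a b : ℝ} (hab : a ≤ b)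
    (h : ∀ τ ∈ Ioo a b, |f τ| ≤ C) : |∫ τ in a..b, f τ| ≤ C * (b - a) := by
  have := intervalIntegral.norm_integral_le_of_norm_le_const_ae (a := a) (b := b)
    (f := f) (C := C) (by
    filter_upwards [Measure.ae_ne volume b] with τ hτ hm
    rw [uIoc_of_le hab] at hm
    exact h τ ⟨hm.1, lt_of_le_of_ne hm.2 hτ⟩)
  rwa [abs_of_nonneg (sub_nonneg.2 hab)] at this

/-- The one-dimensional core of the argument: the energy `J = G + V`, the pressure `P = G / F` and the
dissipation `δ` are dominated by the decrease of one antitone function, and the stability condition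
reverses the dissipation inequality up to errors of higher order. -/
theorem exists_antitoneOn_dominating {T : ℝ} {F J G V P : ℝ → ℝ} {δ : ℝ → ℝ → ℝ}
    {K : NNReal} {m M L : ℝ} (hF : LipschitzOnWith K F (Icc 0 T)) (hm : 0 < m)
    (hFm : ∀ t ∈ Icc 0 T, m ≤ F t) (hL : 0 ≤ L) (hM : 0 ≤ M)
    (hG0 : ∀ t ∈ Icc 0 T, 0 ≤ G t) (hGM : ∀ t ∈ Icc 0 T, G t ≤ M)
    (hJ : ∀ t ∈ Icc 0 T, J t = G t + V t) (hP : ∀ t ∈ Icc 0 T, P t = G t / F t)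
    (hint : IntervalIntegrable (fun τ => 2 * deriv F τ * P τ) volume 0 T)
    (hδ0 : ∀ a b, 0 ≤ δ a b)
    (hV : ∀ a ∈ Icc 0 T, ∀ b ∈ Icc 0 T, |V a - V b| ≤ L * δ a b)
    (hdiss : ∀ a b, 0 ≤ a → a ≤ b → b ≤ T →
      δ a b ≤ J a - J b + ∫ τ in a..b, 2 * deriv F τ * P τ)
    (hstab : ∀ a ∈ Icc 0 T, ∀ b ∈ Icc 0 T, J a ≤ (F a / F b) ^ 2 * G b + V b + δ a b) :
    ∃ (H : ℝ → ℝ) (C : ℝ), AntitoneOn H (Icc 0 T) ∧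
      ∀ a ∈ Icc 0 T, ∀ b ∈ Icc 0 T, a ≤ b →
        δ a b ≤ H a - H b ∧ |J a - J b| ≤ H a - H b ∧ |P a - P b| ≤ H a - H b ∧
        J a - J b + (∫ τ in a..b, 2 * deriv F τ * P τ) ≤
          δ a b + C * (b - a) * (H a - H b) := by
  set g : ℝ → ℝ := fun τ => 2 * deriv F τ * P τ with hg
  have hinc : ∀ a b, 0 ≤ a → a ≤ b → b ≤ T → IntervalIntegrable g volume a b :=
    fun a b ha hab hb => hint.mono_set (by
      rw [uIcc_of_le hab, uIcc_of_le (ha.trans (hab.trans hb))]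
      exact Icc_subset_Icc ha hb)
  have hFpos : ∀ t ∈ Icc 0 T, 0 < F t := fun t ht => hm.trans_le (hFm t ht)
  have hP0 : ∀ t ∈ Icc 0 T, 0 ≤ P t := fun t ht => by
    rw [hP t ht]
    exact div_nonneg (hG0 t ht) (hFpos t ht).le
  have hPM : ∀ t ∈ Icc 0 T, P t ≤ M / m := fun t ht => by
    rw [hP t ht]
    exact div_le_div₀ hM (hGM t ht) hm (hFm t ht)
  have hK : (0 : ℝ) ≤ K := K.2
  have hFK : ∀ a ∈ Icc 0 T, ∀ b ∈ Icc 0 T, a ≤ b → |F a - F b| ≤ K * (b - a) := by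
    intro a ha b hb hab
    have := hF.dist_le_mul a ha b hb
    rwa [Real.dist_eq, dist_comm, Real.dist_eq, abs_of_nonneg (sub_nonneg.2 hab)] at this
  set Q : ℝ := 2 * K * (M / m) with hQ
  have hQ0 : 0 ≤ Q := by positivity
  have hgQ : ∀ a b, 0 ≤ a → a ≤ b → b ≤ T → |∫ τ in a..b, g τ| ≤ Q * (b - a) := by
    intro a b ha hab hb
    refine abs_integral_le_of_interior hab fun τ hτ => ?_
    have hmem : τ ∈ Icc 0 T := ⟨ha.trans hτ.1.le, hτ.2.le.trans hb⟩
    rw [hg, abs_mul, abs_mul, abs_of_nonneg (hP0 τ hmem), abs_two, hQ]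
    gcongr
    · exact hP0 τ hmem
    · exact norm_deriv_le_of_lipschitzOn_Icc hF (ha.trans_lt hτ.1) (hτ.2.trans_le hb)
    · exact hPM τ hmem
  set D : ℝ → ℝ := fun t => J t - ∫ τ in (0 : ℝ)..t, g τ with hD
  have hDsub : ∀ a ∈ Icc 0 T, ∀ b ∈ Icc 0 T, a ≤ b →
      D a - D b = J a - J b + ∫ τ in a..b, g τ := by
    intro a ha b hb hab
    have := intervalIntegral.integral_interval_sub_left (hinc 0 b le_rfl hb.1 hb.2)
      (hinc 0 a le_rfl ha.1 ha.2)
    simp only [hD]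
    linarith
  have hDδ : ∀ a ∈ Icc 0 T, ∀ b ∈ Icc 0 T, a ≤ b → δ a b ≤ D a - D b := fun a ha b hb hab => by
    rw [hDsub a ha b hb hab]
    exact hdiss a b ha.1 hab hb.2
  -- The summands of `α` and `β` are the coefficients of `D a - D b` and `b - a` in the bounds for
  -- `J` and `P`; the extra `1` in `β` gives `b - a ≤ H a - H b`.
  set α : ℝ := 1 + (1 + L) / m with hα
  set β : ℝ := 1 + Q + Q / m + M * K / m ^ 2 with hβ
  have hJle : ∀ a ∈ Icc 0 T, ∀ b ∈ Icc 0 T, a ≤ b →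
      |J a - J b| ≤ (D a - D b) + Q * (b - a) := by
    intro a ha b hb hab
    have h1 := hDsub a ha b hb hab
    have h2 := abs_le.1 (hgQ a b ha.1 hab hb.2)
    have h3 := (hδ0 a b).trans (hDδ a ha b hb hab)
    exact abs_le.2 ⟨by linarith, by linarith⟩
  have hPle : ∀ a ∈ Icc 0 T, ∀ b ∈ Icc 0 T, a ≤ b →
      |P a - P b| ≤ ((1 + L) * (D a - D b) + Q * (b - a)) / m + M * K / m ^ 2 * (b - a) := by
    intro a ha b hb hab
    -- Here `G = J - V`, and the change of `V` is at most `L` times the dissipation.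
    have hGab : |G a - G b| ≤ (1 + L) * (D a - D b) + Q * (b - a) := by
      have h1 := abs_le.1 (hJle a ha b hb hab)
      have h2 := abs_le.1 (hV a ha b hb)
      have h3 := mul_le_mul_of_nonneg_left (hDδ a ha b hb hab) hL
      rw [hJ a ha, hJ b hb] at h1
      exact abs_le.2 ⟨by linarith, by linarith⟩
    have hFa := hFpos a ha
    have hFb := hFpos b hb
    have hsplit : P a - P b = (G a - G b) / F a + G b * (F b - F a) / (F a * F b) := by
      rw [hP a ha, hP b hb]
      field_simp
      ring
    rw [hsplit]
    refine (abs_add_le _ _).trans (add_le_add ?_ ?_)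
    · rw [abs_div, abs_of_pos hFa]
      exact div_le_div₀ ((abs_nonneg _).trans hGab) hGab hm (hFm a ha)
    · rw [abs_div, abs_mul, abs_of_nonneg (hG0 b hb), abs_of_pos (mul_pos hFa hFb), abs_sub_comm,
        div_mul_eq_mul_div, mul_assoc]
      refine div_le_div₀ (by have := sub_nonneg.2 hab; positivity)
        (mul_le_mul (hGM b hb) (hFK a ha b hb hab) (abs_nonneg _) hM) (by positivity) ?_
      rw [sq]
      exact mul_le_mul (hFm a ha) (hFm b hb) hm.le hFa.le
  set H : ℝ → ℝ := fun t => α * D t - β * t with hH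
  have hHsub : ∀ a b, H a - H b = α * (D a - D b) + β * (b - a) := fun a b => by
    simp only [hH]
    ring
  have hHD : ∀ a ∈ Icc 0 T, ∀ b ∈ Icc 0 T, a ≤ b →
      ∀ p q : ℝ, p ≤ α → q ≤ β → p * (D a - D b) + q * (b - a) ≤ H a - H b := by
    intro a ha b hb hab p q hp hq
    rw [hHsub]
    exact add_le_add (mul_le_mul_of_nonneg_right hp ((hδ0 a b).trans (hDδ a ha b hb hab)))
      (mul_le_mul_of_nonneg_right hq (sub_nonneg.2 hab))
  have hLm : 0 ≤ (1 + L) / m := by positivity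
  have hQm : 0 ≤ Q / m := by positivity
  have hMK : 0 ≤ M * K / m ^ 2 := by positivity
  have hδH : ∀ a ∈ Icc 0 T, ∀ b ∈ Icc 0 T, a ≤ b → δ a b ≤ H a - H b := by
    intro a ha b hb hab
    have := hHD a ha b hb hab 1 0 (by linarith) (by linarith)
    have := hDδ a ha b hb hab
    linarith
  have hPH : ∀ a ∈ Icc 0 T, ∀ b ∈ Icc 0 T, a ≤ b → |P a - P b| ≤ H a - H b := by
    intro a ha b hb hab
    refine (hPle a ha b hb hab).trans (le_of_eq_of_le ?_
      (hHD a ha b hb hab ((1 + L) / m) (Q / m + M * K / m ^ 2) (by linarith) (by linarith)))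
    ring
  have hanti : AntitoneOn H (Icc 0 T) := fun a ha b hb hab =>
    sub_nonneg.1 ((hδ0 a b).trans (hδH a ha b hb hab))
  -- In the constant, `2 * K` pays for freezing `P` at `b` in the integral, the rest for the
  -- quadratic remainder of the rescaling.
  refine ⟨H, 2 * K + K ^ 2 * M / m ^ 2, hanti, fun a ha b hb hab =>
    ⟨hδH a ha b hb hab, ?_, hPH a ha b hb hab, ?_⟩⟩
  · refine (hJle a ha b hb hab).trans (le_of_eq_of_le ?_
      (hHD a ha b hb hab 1 Q (by linarith) (by linarith)))
    ring
  have hba := sub_nonneg.2 hab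
  have hac : AbsolutelyContinuousOnInterval F a b :=
    (hF.mono (by rw [uIcc_of_le hab]; exact Icc_subset_Icc ha.1 hb.2)).absolutelyContinuousOnInterval
  have hftc : ∫ τ in a..b, 2 * deriv F τ * P b = 2 * (F b - F a) * P b := by
    rw [intervalIntegral.integral_mul_const, intervalIntegral.integral_const_mul,
      hac.integral_deriv_eq_sub]
  have hosc : |(∫ τ in a..b, g τ) - 2 * (F b - F a) * P b| ≤ 2 * K * (H a - H b) * (b - a) := by
    rw [← hftc, ← intervalIntegral.integral_sub (hinc a b ha.1 hab hb.2)
      ((hac.intervalIntegrable_deriv.const_mul 2).mul_const _)]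
    refine abs_integral_le_of_interior hab fun τ hτ => ?_
    have hmem : τ ∈ Icc 0 T := ⟨ha.1.trans hτ.1.le, hτ.2.le.trans hb.2⟩
    have h1 := (hPH τ hmem b hb hτ.2.le).trans (sub_le_sub_right (hanti ha hmem hτ.1.le) _)
    simp only [hg]
    rw [← mul_sub, abs_mul, abs_mul, abs_two]
    gcongr
    exact norm_deriv_le_of_lipschitzOn_Icc hF (ha.1.trans_lt hτ.1) (hτ.2.trans_le hb.2)
  have hquad : (F a / F b) ^ 2 * G b - G b + 2 * (F b - F a) * P b ≤
      K ^ 2 * M / m ^ 2 * (b - a) ^ 2 := by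
    have hFb := hFpos b hb
    -- Inserting `P b = G b / F b` cancels the linear term and leaves an exact square.
    have heq : (F a / F b) ^ 2 * G b - G b + 2 * (F b - F a) * P b =
        ((F a - F b) ^ 2 * G b) / F b ^ 2 := by
      rw [hP b hb]
      field_simp
      ring
    have hsq : (F a - F b) ^ 2 ≤ (K * (b - a)) ^ 2 :=
      sq_le_sq' (abs_le.1 (hFK a ha b hb hab)).1 (abs_le.1 (hFK a ha b hb hab)).2
    rw [heq]
    refine (div_le_div₀ (by positivity) (mul_le_mul hsq (hGM b hb) (hG0 b hb) (by positivity))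
      (by positivity) (pow_le_pow_left₀ hm.le (hFm b hb) 2)).trans_eq ?_
    ring
  have hlin : (b - a) ^ 2 ≤ (b - a) * (H a - H b) := by
    have := hHD a ha b hb hab 0 1 (by linarith) (by linarith)
    nlinarith
  have h1 := hstab a ha b hb
  have h2 := (abs_le.1 hosc).2
  have h3 := mul_le_mul_of_nonneg_left hlin (by positivity : 0 ≤ (K : ℝ) ^ 2 * M / m ^ 2)
  rw [hJ b hb]
  linarith


/-! ### Dissipation against symmetric difference; energy bound -/

/-- In the expanded product the diagonal terms give the symmetric difference and the cross terms are
nonnegative. -/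
theorem measure_sdiff_add_sdiff_le {μp μm : ℝ} (hp : 0 < μp) (hm : 0 < μm) {A B : Set (Euc d)}
    (hA : volume A ≠ ⊤) (hB : volume B ≠ ⊤) :
    volume.real (A \ B) + volume.real (B \ A) ≤ (1 / μp + 1 / μm) * (diss μp μm A B).toReal := by
  have h1 : 0 ≤ volume.real (A \ B) := measureReal_nonneg
  have h2 : 0 ≤ volume.real (B \ A) := measureReal_nonneg
  rw [diss_toReal hp.le hm.le hA hB]
  have : (1 / μp + 1 / μm) * (μp * volume.real (B \ A) + μm * volume.real (A \ B)) =
      volume.real (A \ B) + volume.real (B \ A) +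
        (μm / μp * volume.real (A \ B) + μp / μm * volume.real (B \ A)) := by
    field_simp
    ring
  rw [this]
  exact le_add_of_nonneg_right (by positivity)

theorem abs_measureReal_sub_le {A B : Set (Euc d)} (hAm : MeasurableSet A) (hBm : MeasurableSet B)
    (hA : volume A ≠ ⊤) (hB : volume B ≠ ⊤) :
    |volume.real A - volume.real B| ≤ volume.real (A \ B) + volume.real (B \ A) := by
  have e1 := measureReal_inter_add_sdiff (μ := volume) (s := A) hBm hA
  have e2 := measureReal_inter_add_sdiff (μ := volume) (s := B) hAm hB
  rw [inter_comm] at e2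
  have h1 : 0 ≤ volume.real (A \ B) := measureReal_nonneg
  have h2 : 0 ≤ volume.real (B \ A) := measureReal_nonneg
  exact abs_le.2 ⟨by linarith, by linarith⟩

theorem edist_Lp_indicator_le {A B : Set (Euc d)} (hAm : MeasurableSet A) (hBm : MeasurableSet B)
    (hA : volume A ≠ ⊤) (hB : volume B ≠ ⊤) {f g : Lp ℝ 1 (volume : Measure (Euc d))}
    (hf : f =ᵐ[volume] A.indicator fun _ => (1 : ℝ))
    (hg : g =ᵐ[volume] B.indicator fun _ => (1 : ℝ)) :
    edist f g ≤ ENNReal.ofReal (volume.real (A \ B) + volume.real (B \ A)) := by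
  rw [ENNReal.ofReal_add measureReal_nonneg measureReal_nonneg,
    ofReal_measureReal (measure_ne_top_of_subset sdiff_subset hA),
    ofReal_measureReal (measure_ne_top_of_subset sdiff_subset hB), L1.edist_def,
    ← lintegral_indicator_one (hAm.diff hBm), ← lintegral_indicator_one (hBm.diff hAm),
    ← lintegral_add_left (measurable_one.indicator (hAm.diff hBm))]
  refine lintegral_mono_ae ?_
  filter_upwards [hf, hg] with x h1 h2
  rw [h1, h2]
  by_cases hxA : x ∈ A <;> by_cases hxB : x ∈ B <;> simp [hxA, hxB, edist_dist]

/-- The Dirichlet energy of a stable function is bounded by that of a competitor, up to measure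
terms. -/
theorem IsStable.dirichlet_le (hU : IsOpen U) {μp μm : ℝ} (hp : 0 ≤ μp) (hm : 0 ≤ μm)
    (hm1 : μm ≤ 1) {u v : H1 U} (h : IsStable μp μm u) (hu : energy u ≠ ⊤)
    (hv : volume (posSet v) ≠ ⊤) (huv : v - u ∈ H10 U) :
    ‖u.1.2‖ ^ 2 ≤ ‖v.1.2‖ ^ 2 + (1 + μp) * volume.real (posSet v) := by
  have hA := volume_posSet_ne_top hU hu
  have h1 := h.toReal_le hU hu hv huv
  rw [diss_toReal hp hm hA hv] at h1
  have h2 : volume.real (posSet v \ posSet u) ≤ volume.real (posSet v) :=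
    measureReal_mono sdiff_subset hv
  have h3 : volume.real (posSet u \ posSet v) ≤ volume.real (posSet u) :=
    measureReal_mono sdiff_subset hA
  have h4 : 0 ≤ volume.real (posSet u \ posSet v) := measureReal_nonneg
  -- As `μm ≤ 1`, the shrinking cost is absorbed by the measure of the positivity set of `u` on the
  -- left.
  nlinarith [mul_le_mul_of_nonneg_left h2 hp]

/-! ### Energy solutions -/

namespace IsEnergySolution

variable {μp μm T : ℝ} {F : ℝ → ℝ} {u : ℝ → H1 U}

theorem isFlux (hu : IsEnergySolution U μp μm T F u) (hU : IsOpen U) (hp : 0 ≤ μp) (hm : 0 ≤ μm)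
    (hm1 : μm ≤ 1) (hF : ∀ t ∈ Icc 0 T, 0 < F t) {t : ℝ} (ht : t ∈ Icc 0 T) :
    IsFlux (u t) ((F t)⁻¹ * ‖(u t).1.2‖ ^ 2) :=
  IsStable.isFlux hU hp hm hm1 (hu.stability t ht) (hu.finite_energy t ht) (hu.nonneg t ht)
    (hF t ht) (hu.forcing t ht)

/-- The competitor at time `t` is `F t • e` with one cutoff `e`, provided by the trace condition at
time zero; its positivity set does not depend on `t`, up to null sets. -/
theorem exists_dirichlet_le (hu : IsEnergySolution U μp μm T F u) (hU : IsOpen U) (hp : 0 ≤ μp)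
    (hm : 0 ≤ μm) (hm1 : μm ≤ 1) (hT : 0 ≤ T) (hF : ∀ t ∈ Icc 0 T, 0 < F t)
    (hFc : ContinuousOn F (Icc 0 T)) :
    ∃ M, 0 ≤ M ∧ ∀ t ∈ Icc 0 T, ‖(u t).1.2‖ ^ 2 ≤ M := by
  obtain ⟨e, he, -⟩ := hu.forcing 0 (left_mem_Icc.2 hT)
  obtain ⟨R, hR⟩ := isCompact_Icc.exists_bound_of_continuousOn hFc
  refine ⟨R ^ 2 * ‖e.1.2‖ ^ 2 + (1 + μp) * volume.real (posSet e), ?_, fun t ht => ?_⟩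
  · have : 0 ≤ volume.real (posSet e) := measureReal_nonneg
    positivity
  have hpos := posSet_smul_ae hU (hF t ht) e
  have hv : volume (posSet (F t • e)) ≠ ⊤ := by
    rw [measure_congr hpos]
    exact he.volume_posSet_ne_top hU
  have h1 := IsStable.dirichlet_le hU hp hm hm1 (hu.stability t ht) (hu.finite_energy t ht) hv
    ((he.hasTrace (F t)).sub_mem_H10 (hu.forcing t ht))
  rw [measureReal_congr hpos] at h1
  refine h1.trans (add_le_add_left ?_ _)
  have hn : (F t • e).1.2 = F t • e.1.2 := rfl
  rw [hn, norm_smul, mul_pow]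
  gcongr
  exact hR t ht

/-- The identity `P = G / F` makes the pressure measurable and bounded, and `F'` is integrable by
absolute continuity. -/
theorem intervalIntegrable (hu : IsEnergySolution U μp μm T F u) (hU : IsOpen U) (hp : 0 ≤ μp)
    (hm : 0 ≤ μm) (hm1 : μm ≤ 1) (hT : 0 ≤ T) (hF : ∀ t ∈ Icc 0 T, 0 < F t) {K : NNReal}
    (hFL : LipschitzOnWith K F (Icc 0 T)) :
    IntervalIntegrable (fun τ => 2 * deriv F τ * pressure (u τ)) volume 0 T := by
  obtain ⟨M, hM, hGM⟩ := hu.exists_dirichlet_le hU hp hm hm1 hT hF hFL.continuousOn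
  have hinv : ContinuousOn (fun t => (F t)⁻¹) (Icc 0 T) :=
    hFL.continuousOn.inv₀ fun t ht => (hF t ht).ne'
  obtain ⟨R, hR⟩ := isCompact_Icc.exists_bound_of_continuousOn hinv
  have hgrad : AEStronglyMeasurable (fun t => ‖(u t).1.2‖ ^ 2) (volume.restrict (Icc 0 T)) :=
    (show Continuous fun v : H1 U => ‖v.1.2‖ ^ 2 by fun_prop).comp_aestronglyMeasurable
      hu.measurable
  have hpr : ∀ t ∈ Icc 0 T, pressure (u t) = (F t)⁻¹ * ‖(u t).1.2‖ ^ 2 := fun t ht =>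
    (hu.isFlux hU hp hm hm1 hF ht).pressure_eq
  have hPm : AEStronglyMeasurable (fun t => pressure (u t)) (volume.restrict (Icc 0 T)) := by
    refine ((hinv.aestronglyMeasurable measurableSet_Icc).mul hgrad).congr ?_
    filter_upwards [ae_restrict_mem measurableSet_Icc] with t ht
    exact (hpr t ht).symm
  have hac : AbsolutelyContinuousOnInterval F 0 T :=
    LipschitzOnWith.absolutelyContinuousOnInterval (K := K) (by rwa [uIcc_of_le hT])
  have hd := hac.intervalIntegrable_deriv.const_mul 2
  rw [intervalIntegrable_iff_integrableOn_Icc_of_le hT] at hd ⊢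
  refine Integrable.mul_bdd (c := R * M) hd hPm ?_
  filter_upwards [ae_restrict_mem measurableSet_Icc] with t ht
  rw [hpr t ht, norm_mul, Real.norm_of_nonneg (sq_nonneg _)]
  exact mul_le_mul (hR t ht) (hGM t ht) (sq_nonneg _) ((norm_nonneg _).trans (hR t ht))

/-- The competitor `(F a / F b) u b` in the stability of `u a`. -/
theorem energy_le_rescaled (hu : IsEnergySolution U μp μm T F u) (hU : IsOpen U)
    (hF : ∀ t ∈ Icc 0 T, 0 < F t) {a b : ℝ} (ha : a ∈ Icc 0 T) (hb : b ∈ Icc 0 T) :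
    (energy (u a)).toReal ≤ (F a / F b) ^ 2 * ‖(u b).1.2‖ ^ 2 + volume.real (posSet (u b)) +
      (diss μp μm (posSet (u a)) (posSet (u b))).toReal := by
  have hr : 0 < F a / F b := div_pos (hF a ha) (hF b hb)
  have hpos := posSet_smul_ae hU hr (u b)
  have htr : HasTrace ((F a / F b) • u b) (F a) := by
    have := (hu.forcing b hb).smul (F a / F b)
    rwa [div_mul_cancel₀ _ (hF b hb).ne'] at this
  have h := IsStable.toReal_le hU (hu.stability a ha) (hu.finite_energy a ha)
    (v := (F a / F b) • u b)
    (by rw [measure_congr hpos]; exact volume_posSet_ne_top hU (hu.finite_energy b hb))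
    (htr.sub_mem_H10 (hu.forcing a ha))
  have hn : ((F a / F b) • u b).1.2 = (F a / F b) • (u b).1.2 := rfl
  rwa [← energy_toReal hU (hu.finite_energy a ha), diss_congr_right hpos, measureReal_congr hpos,
    hn, norm_smul, mul_pow, Real.norm_of_nonneg hr.le] at h

/-- Along an energy solution the dissipation, the energy and the pressure are dominated by the
decrease of one antitone function. -/
theorem exists_antitoneOn_dominating (hu : IsEnergySolution U μp μm T F u) (hU : IsOpen U)
    (hp : 0 < μp) (hm : 0 < μm) (hm1 : μm ≤ 1) (hT : 0 ≤ T) (hF : ∀ t ∈ Icc 0 T, 0 < F t)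
    {K : NNReal} (hFL : LipschitzOnWith K F (Icc 0 T)) :
    ∃ (H : ℝ → ℝ) (C : ℝ), AntitoneOn H (Icc 0 T) ∧
      ∀ a ∈ Icc 0 T, ∀ b ∈ Icc 0 T, a ≤ b →
        (diss μp μm (posSet (u a)) (posSet (u b))).toReal ≤ H a - H b ∧
        |(energy (u a)).toReal - (energy (u b)).toReal| ≤ H a - H b ∧
        |pressure (u a) - pressure (u b)| ≤ H a - H b ∧
        (energy (u a)).toReal - (energy (u b)).toReal
            + (∫ τ in a..b, 2 * deriv F τ * pressure (u τ)) ≤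
          (diss μp μm (posSet (u a)) (posSet (u b))).toReal + C * (b - a) * (H a - H b) := by
  obtain ⟨M, hM, hGM⟩ := hu.exists_dirichlet_le hU hp.le hm.le hm1 hT hF hFL.continuousOn
  obtain ⟨t₀, ht₀, hmin⟩ := isCompact_Icc.exists_isMinOn (nonempty_Icc.2 hT) hFL.continuousOn
  refine Droplet.exists_antitoneOn_dominating (G := fun t => ‖(u t).1.2‖ ^ 2)
    (V := fun t => volume.real (posSet (u t))) (m := F t₀) (M := M) (L := 1 / μp + 1 / μm) hFL
    (hF t₀ ht₀) (fun t ht => hmin ht) (by positivity) hM (fun t _ => sq_nonneg _) hGM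
    (fun t ht => energy_toReal hU (hu.finite_energy t ht)) (fun t ht => ?_)
    (hu.intervalIntegrable hU hp.le hm.le hm1 hT hF hFL) (fun _ _ => ENNReal.toReal_nonneg)
    (fun a ha b hb => ?_) hu.dissipation (fun a ha b hb => hu.energy_le_rescaled hU hF ha hb)
  · rw [(hu.isFlux hU hp.le hm.le hm1 hF ht).pressure_eq, div_eq_inv_mul]
  · have hA := volume_posSet_ne_top hU (hu.finite_energy a ha)
    have hB := volume_posSet_ne_top hU (hu.finite_energy b hb)
    exact (abs_measureReal_sub_le (measurableSet_posSet hU _) (measurableSet_posSet hU _)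
      hA hB).trans (measure_sdiff_add_sdiff_le hp hm hA hB)

theorem diss_ne_top (hu : IsEnergySolution U μp μm T F u) (hU : IsOpen U) {a b : ℝ}
    (ha : a ∈ Icc 0 T) (hb : b ∈ Icc 0 T) : diss μp μm (posSet (u a)) (posSet (u b)) ≠ ⊤ :=
  Droplet.diss_ne_top (volume_posSet_ne_top hU (hu.finite_energy a ha))
    (volume_posSet_ne_top hU (hu.finite_energy b hb))

/-- One half of the energy balance, directly from the dissipation inequality. -/
theorem dissBar_le (hu : IsEnergySolution U μp μm T F u) (hU : IsOpen U)
    (hint : IntervalIntegrable (fun τ => 2 * deriv F τ * pressure (u τ)) volume 0 T) {s t : ℝ}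
    (hs : 0 ≤ s) (hst : s ≤ t) (ht : t ≤ T) :
    dissBar μp μm (fun τ => posSet (u τ)) s t ≤
      ENNReal.ofReal ((energy (u s)).toReal - (energy (u t)).toReal
        + ∫ τ in s..t, 2 * deriv F τ * pressure (u τ)) := by
  have hinc : ∀ b, 0 ≤ b → b ≤ T →
      IntervalIntegrable (fun τ => 2 * deriv F τ * pressure (u τ)) volume 0 b :=
    fun b hb0 hbT => hint.mono_set (by
      rw [uIcc_of_le hb0, uIcc_of_le (hb0.trans hbT)]
      exact Icc_subset_Icc_right hbT)
  set D : ℝ → ℝ := fun t =>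
    (energy (u t)).toReal - ∫ τ in (0 : ℝ)..t, 2 * deriv F τ * pressure (u τ) with hD
  have hsub : ∀ a ∈ Icc s t, ∀ b ∈ Icc s t, D a - D b =
      (energy (u a)).toReal - (energy (u b)).toReal
        + ∫ τ in a..b, 2 * deriv F τ * pressure (u τ) := by
    intro a ha b hb
    have := intervalIntegral.integral_interval_sub_left
      (hinc b (hs.trans hb.1) (hb.2.trans ht)) (hinc a (hs.trans ha.1) (ha.2.trans ht))
    simp only [hD]
    linarith
  have hle : ∀ a ∈ Icc s t, ∀ b ∈ Icc s t, a ≤ b →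
      (diss μp μm (posSet (u a)) (posSet (u b))).toReal ≤ D a - D b := by
    intro a ha b hb hab
    rw [hsub a ha b hb]
    exact hu.dissipation a b (hs.trans ha.1) hab (hb.2.trans ht)
  rw [← hsub s (left_mem_Icc.2 hst) t (right_mem_Icc.2 hst)]
  refine iSup_le fun N => iSup_le fun τ => iSup_le fun ⟨hτ, h0, hN⟩ => ?_
  have := sum_cost_le_of_antitoneOn (c := fun a b => diss μp μm (posSet (u a)) (posSet (u b)))
    (H := D) (S := Icc s t)
    (fun a ha b hb hab => sub_nonneg.1 (ENNReal.toReal_nonneg.trans (hle a ha b hb hab)))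
    (fun a ha b hb hab => ENNReal.le_ofReal_iff_toReal_le
      (hu.diss_ne_top hU ⟨hs.trans ha.1, ha.2.trans ht⟩ ⟨hs.trans hb.1, hb.2.trans ht⟩)
      (ENNReal.toReal_nonneg.trans (hle a ha b hb hab)) |>.2 (hle a ha b hb hab)) hτ (N := N)
    (fun k hk => ⟨h0 ▸ hτ k.zero_le, hN ▸ hτ hk⟩)
  rwa [h0, hN] at this

theorem exists_indicator (hu : IsEnergySolution U μp μm T F u) (hU : IsOpen U) :
    ∃ χ : ℝ → Lp ℝ 1 (volume : Measure (Euc d)),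
      ∀ t ∈ Icc 0 T, χ t =ᵐ[volume] (posSet (u t)).indicator fun _ => (1 : ℝ) := by
  have h : ∀ t, ∃ f : Lp ℝ 1 (volume : Measure (Euc d)), t ∈ Icc 0 T →
      f =ᵐ[volume] (posSet (u t)).indicator fun _ => (1 : ℝ) := fun t => by
    by_cases ht : t ∈ Icc 0 T
    · exact ⟨indicatorConstLp 1 (measurableSet_posSet hU (u t))
        (volume_posSet_ne_top hU (hu.finite_energy t ht)) 1, fun _ => indicatorConstLp_coeFn⟩
    -- Off `[0, T]` the positivity set may have infinite measure, so a default value is taken.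
    · exact ⟨0, fun h => absurd h ht⟩
  choose χ hχ using h
  exact ⟨χ, hχ⟩

theorem energy_balance (hu : IsEnergySolution U μp μm T F u) (hU : IsOpen U)
    (hp : 0 < μp) (hm : 0 < μm) (hm1 : μm ≤ 1) (hT : 0 ≤ T) (hF : ∀ t ∈ Icc 0 T, 0 < F t)
    {K : NNReal} (hFL : LipschitzOnWith K F (Icc 0 T)) {s t : ℝ} (hs : 0 ≤ s) (hst : s ≤ t)
    (ht : t ≤ T) :
    dissBar μp μm (fun τ => posSet (u τ)) s t ≠ ⊤ ∧
      (energy (u s)).toReal - (energy (u t)).toReal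
          + ∫ τ in s..t, 2 * deriv F τ * pressure (u τ) =
        (dissBar μp μm (fun τ => posSet (u τ)) s t).toReal := by
  have hint := hu.intervalIntegrable hU hp.le hm.le hm1 hT hF hFL
  have hle := hu.dissBar_le hU hint hs hst ht
  have hfin := ne_top_of_le_ne_top ENNReal.ofReal_ne_top hle
  refine ⟨hfin, le_antisymm ?_ ?_⟩
  -- Stability yields this inequality, through refining partitions; the other one is telescoped
  -- dissipation.
  · obtain ⟨H, C, -, hH⟩ := hu.exists_antitoneOn_dominating hU hp hm hm1 hT hF hFL
    have hinc : ∀ b ∈ Icc s t,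
        IntervalIntegrable (fun τ => 2 * deriv F τ * pressure (u τ)) volume 0 b :=
      fun b hb => hint.mono_set (by
        rw [uIcc_of_le (hs.trans hb.1), uIcc_of_le hT]
        exact Icc_subset_Icc_right (hb.2.trans ht))
    have hsub : ∀ a ∈ Icc s t, ∀ b ∈ Icc s t,
        ((energy (u a)).toReal - ∫ τ in (0 : ℝ)..a, 2 * deriv F τ * pressure (u τ)) -
          ((energy (u b)).toReal - ∫ τ in (0 : ℝ)..b, 2 * deriv F τ * pressure (u τ)) =
        (energy (u a)).toReal - (energy (u b)).toReal
          + ∫ τ in a..b, 2 * deriv F τ * pressure (u τ) := by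
      intro a ha b hb
      have := intervalIntegral.integral_interval_sub_left (hinc b hb) (hinc a ha)
      linarith
    rw [← hsub s (left_mem_Icc.2 hst) t (right_mem_Icc.2 hst)]
    refine sub_le_of_increment_le
      (E := fun t => (energy (u t)).toReal - ∫ τ in (0 : ℝ)..t, 2 * deriv F τ * pressure (u τ))
      (H := H) (C := C) (δ := fun a b => (diss μp μm (posSet (u a)) (posSet (u b))).toReal) hst
      (fun a ha b hb hab => ?_) (fun N τ hτ h0 hN => ?_)
    · rw [hsub a ha b hb]
      exact (hH a ⟨hs.trans ha.1, ha.2.trans ht⟩ b ⟨hs.trans hb.1, hb.2.trans ht⟩ hab).2.2.2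
    · have hmem : ∀ k ≤ N, τ k ∈ Icc 0 T := fun k hk =>
        ⟨hs.trans (h0 ▸ hτ k.zero_le), (hτ hk).trans (hN ▸ ht)⟩
      rw [← ENNReal.toReal_sum fun k hk => hu.diss_ne_top hU
        (hmem k (Finset.mem_range.1 hk).le) (hmem (k + 1) (Finset.mem_range.1 hk))]
      exact ENNReal.toReal_mono hfin (le_iSup_of_le N (le_iSup_of_le τ
        (le_iSup_of_le ⟨hτ, h0, hN⟩ le_rfl)))
  · exact ENNReal.toReal_le_of_le_ofReal
      (ENNReal.toReal_nonneg.trans (hu.dissipation s t hs hst ht)) hle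

end IsEnergySolution

end Droplet

/-! ### The main theorem -/

theorem lemma3p5 {d : ℕ} (U : Set (Droplet.Euc d)) (hUo : IsOpen U) (hUc : IsConnected U)
    (hUk : IsCompact Uᶜ) (μp μm : ℝ) (hμp : 0 < μp) (hμm : 0 < μm) (hμm1 : μm < 1)
    (T : ℝ) (hT : 0 ≤ T) (F : ℝ → ℝ) (hF : ∀ t ∈ Icc 0 T, 0 < F t)
    (hFL : ∃ K, LipschitzOnWith K F (Icc 0 T))
    (u : ℝ → Droplet.H1 U) (hu : Droplet.IsEnergySolution U μp μm T F u) :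
    (∃ χ : ℝ → Lp ℝ 1 (volume : Measure (Droplet.Euc d)),
      (∀ t ∈ Icc 0 T, χ t =ᵐ[volume] (Droplet.posSet (u t)).indicator (fun _ => (1 : ℝ))) ∧
      BoundedVariationOn χ (Icc 0 T)) ∧
    BoundedVariationOn (fun t => (Droplet.energy (u t)).toReal) (Icc 0 T) ∧
    BoundedVariationOn (fun t => Droplet.pressure (u t)) (Icc 0 T) ∧
    (∀ t ∈ Icc 0 T, Droplet.IsFlux (u t) (Droplet.pressure (u t)) ∧
      Droplet.pressure (u t) = (F t)⁻¹ * ∫ x in U, ‖Droplet.grad (u t) x‖ ^ 2) ∧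
    IntervalIntegrable (fun τ => 2 * deriv F τ * Droplet.pressure (u τ)) volume 0 T ∧
    (∀ s t : ℝ, 0 ≤ s → s ≤ t → t ≤ T →
      Droplet.dissBar μp μm (fun τ => Droplet.posSet (u τ)) s t ≠ ⊤ ∧
      (Droplet.energy (u s)).toReal - (Droplet.energy (u t)).toReal
          + ∫ τ in s..t, 2 * deriv F τ * Droplet.pressure (u τ) =
        (Droplet.dissBar μp μm (fun τ => Droplet.posSet (u τ)) s t).toReal) := by
  obtain ⟨K, hK⟩ := hFL
  obtain ⟨H, C, hH, hdom⟩ := hu.exists_antitoneOn_dominating hUo hμp hμm hμm1.le hT hF hK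
  obtain ⟨χ, hχ⟩ := hu.exists_indicator hUo
  refine ⟨⟨χ, hχ, ?_⟩, ?_, ?_, fun t ht => ?_,
    hu.intervalIntegrable hUo hμp.le hμm.le hμm1.le hT hF hK,
    fun s t hs hst ht => hu.energy_balance hUo hμp hμm hμm1.le hT hF hK hs hst ht⟩
  · have hL : 0 ≤ 1 / μp + 1 / μm := by positivity
    -- Rescaling `H` absorbs the constant between symmetric difference and dissipation.
    refine Droplet.boundedVariationOn_of_edist_le (H := fun t => (1 / μp + 1 / μm) * H t)
      (fun a ha b hb hab => mul_le_mul_of_nonneg_left (hH ha hb hab) hL)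
      fun a ha b hb hab => ?_
    have hA := Droplet.volume_posSet_ne_top hUo (hu.finite_energy a ha)
    have hB := Droplet.volume_posSet_ne_top hUo (hu.finite_energy b hb)
    refine (Droplet.edist_Lp_indicator_le (Droplet.measurableSet_posSet hUo _)
      (Droplet.measurableSet_posSet hUo _) hA hB (hχ a ha) (hχ b hb)).trans
      (ENNReal.ofReal_le_ofReal ?_)
    rw [← mul_sub]
    exact (Droplet.measure_sdiff_add_sdiff_le hμp hμm hA hB).trans
      (mul_le_mul_of_nonneg_left (hdom a ha b hb hab).1 hL)
  · refine Droplet.boundedVariationOn_of_edist_le hH fun a ha b hb hab => ?_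
    rw [edist_dist]
    exact ENNReal.ofReal_le_ofReal (hdom a ha b hb hab).2.1
  · refine Droplet.boundedVariationOn_of_edist_le hH fun a ha b hb hab => ?_
    rw [edist_dist]
    exact ENNReal.ofReal_le_ofReal (hdom a ha b hb hab).2.2.1
  · have hflux := hu.isFlux hUo hμp.le hμm.le hμm1.le hF ht
    rw [hflux.pressure_eq, Droplet.integral_grad_sq]
    exact ⟨hflux, rfl⟩
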